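/- Let $X$ be a complex Banach space, $L(X)$ the algebra of bounded linear operators on $X$, and $T\in L(X)$. Throughout, $\sigma_*$ is one of the following: the spectrum $\sigma$; the Browder spectrum $\sigma_b(T)=\{z: T-zI$ is not Browder$\}$, where Browder means Fredholm with finite ascent and finite descent; the Drazin spectrum $\sigma_d(T)=\{z: T-zI$ is not Drazin invertible$\}$, where Drazin invertible means having finite ascent and finite descent. For $A\subset\mathbb C$ let $\mathrm{acc}\,A$ be the set of accumulation points of $A$, and define the Cantor–Bendixson derivatives by $\mathrm{acc}^0A=A$, $\mathrm{acc}^{\beta+1}A=\mathrm{acc}(\mathrm{acc}^{\beta}A)$, and $\mathrm{acc}^{\delta}A=\bigcap_{\beta<\delta}\mathrm{acc}^{\beta}A$ for limit ordinals $\delta$. Write $(M,N)\in\mathrm{Red}(T)$ if $M,N$ are closed $T$-invariant subspaces with $X=M\oplus N$; $T_M$ denotes the restriction of $T$ to $M$. Put $\mathrm{comm}(T)=\{S\in L(X): ST=TS\}$ and $\mathrm{comm}^2(T)=\{S\in L(X): SR=RS\text{ for all }R\in\mathrm{comm}(T)\}$, and write $(M,N)\in\mathrm{Red}^2(T)$ if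 $(M,N)\in\mathrm{Red}(S)$ for every $S\in\mathrm{comm}(T)$. For a successor ordinal $\alpha$ with predecessor $\alpha-1$, let $g^{\alpha}_{\sigma_*}\mathcal D(T)$ be the set of all $(M,N)\in\mathrm{Red}(T)$ such that $T_M$ is invertible and $\mathrm{acc}^{\alpha-1}\sigma_*(T_N)\subset\{0\}$, and let $\Pi^{\alpha}_{\sigma_*}(T)=\sigma(T)\setminus\mathrm{acc}^{\alpha-1}\sigma_*(T)$. A spectral set of $T$ is a subset of $\sigma(T)$ that is clopen in $\sigma(T)$. The operator $T$ is called $g^{0}_{\sigma_*}$-invertible if $0\notin\sigma_*(T)$; $g^{\alpha}_{\sigma_*}$-invertible, for a successor ordinal $\alpha$, if $g^{\alpha}_{\sigma_*}\mathcal D(T)\neq\emptyset$; and $g^{\alpha}_{\sigma_*}$-invertible, for a limit ordinal $\alpha$, if it is $g^{\beta}_{\sigma_*}$-invertible for some successor ordinal $\beta<\alpha$. **Theorem.** Let $\alpha\ge 1$ be a successor ordinal. For every $T\in L(X)$ the following statements are equivalent: (i) $T$ is $g^{\alpha}_{\sigma_*}$-invertible; (ii) $0\notin\mathrm{acc}^{\alpha}\sigma_*(T)$;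 (iii) there exists $(M,N)\in\mathrm{Red}^2(T)\cap g^{\alpha}_{\sigma_*}\mathcal D(T)$; (iv) there exists a spectral set $\tilde\sigma$ of $T$ such that $0\notin\sigma(T)\setminus\tilde\sigma$ and $\tilde\sigma\setminus\{0\}\subset\Pi^{\alpha}_{\sigma_*}(T)$; (v) there exists a bounded projection $P\in\mathrm{comm}(T)$ such that $T+P$ is $g^{\alpha-1}_{\sigma_*}$-invertible and $\mathrm{acc}^{\alpha-1}\sigma_*(TP)\subset\{0\}$; (vi) there exists a bounded projection $P\in\mathrm{comm}^2(T)$ such that $T+P$ is $g^{\alpha-1}_{\sigma_*}$-invertible and $\mathrm{acc}^{\alpha-1}\sigma_*(TP)\subset\{0\}$; (vii) there exists $S\in\mathrm{comm}(T)$ such that $S^2T=S$ and $\mathrm{acc}^{\alpha-1}\sigma_*(T-T^2S)\subset\{0\}$; (viii) there exists $S\in\mathrm{comm}^2(T)$ such that $S^2T=S$ and $\mathrm{acc}^{\alpha-1}\sigma_*(T-T^2S)\subset\{0\}$. -/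

import Mathlib

/-- The `α`-th Cantor-Bendixson derivative `acc^α A` of a set `A ⊆ ℂ`: `acc^0 A = A`,
`acc^(β+1) A = acc (acc^β A)` and, for a limit ordinal, the intersection of the earlier
derivatives; `derivedSet B` is the set of accumulation points of `B` in `ℂ`. -/
noncomputable def cbDeriv (A : Set ℂ) (α : Ordinal) : Set ℂ :=
  Ordinal.limitRecOn (motive := fun _ => Set ℂ) α A (fun _ B => derivedSet B)
    (fun δ _ D => ⋂ (β : Ordinal) (h : β < δ), D β h)

theorem cbDeriv_zero (A : Set ℂ) : cbDeriv A 0 = A :=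
  Ordinal.limitRecOn_zero (motive := fun _ => Set ℂ) _ _ _

theorem cbDeriv_add_one (A : Set ℂ) (β : Ordinal) :
    cbDeriv A (β + 1) = derivedSet (cbDeriv A β) :=
  Ordinal.limitRecOn_add_one (motive := fun _ => Set ℂ) _ _ _ _

theorem cbDeriv_limit (A : Set ℂ) (δ : Ordinal) (h : Order.IsSuccLimit δ) :
    cbDeriv A δ = ⋂ (β : Ordinal) (_ : β < δ), cbDeriv A β :=
  Ordinal.limitRecOn_limit (motive := fun _ => Set ℂ) _ _ _ _ h

section Operators

variable {X : Type*} [NormedAddCommGroup X] [NormedSpace ℂ X]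

/-- `T` has finite ascent: `N(T^n) = N(T^(n+1))` for some `n`. -/
def HasFiniteAscent (T : X →L[ℂ] X) : Prop :=
  ∃ n : ℕ, (T ^ n).ker = (T ^ (n + 1)).ker

/-- `T` has finite descent: `R(T^n) = R(T^(n+1))` for some `n`. -/
def HasFiniteDescent (T : X →L[ℂ] X) : Prop :=
  ∃ n : ℕ, (T ^ n).range = (T ^ (n + 1)).range

/-- `T` is Drazin invertible: it has finite ascent and finite descent. -/
def IsDrazinInvertible (T : X →L[ℂ] X) : Prop :=
  HasFiniteAscent T ∧ HasFiniteDescent T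

/-- `T` is a Browder operator: a Fredholm operator of finite ascent and finite descent. -/
def IsBrowder (T : X →L[ℂ] X) : Prop :=
  T.IsFredholm ∧ HasFiniteAscent T ∧ HasFiniteDescent T

/-- The Browder spectrum `σ_b(T)`. -/
def browderSpectrum (T : X →L[ℂ] X) : Set ℂ :=
  {z : ℂ | ¬ IsBrowder (T - z • (1 : X →L[ℂ] X))}

/-- The Drazin spectrum `σ_d(T)`. -/
def drazinSpectrum (T : X →L[ℂ] X) : Set ℂ :=
  {z : ℂ | ¬ IsDrazinInvertible (T - z • (1 : X →L[ℂ] X))}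

/-- The three choices for the symbol `σ_*`. -/
inductive SpectrumKind where
  | ordinary
  | browder
  | drazin

/-- The set `σ_*(T)`, for `σ_*` one of the spectrum `σ`, the Browder spectrum `σ_b` and the
Drazin spectrum `σ_d`. -/
def starSpectrum (s : SpectrumKind) (T : X →L[ℂ] X) : Set ℂ :=
  match s with
  | SpectrumKind.ordinary => spectrum ℂ T
  | SpectrumKind.browder => browderSpectrum T
  | SpectrumKind.drazin => drazinSpectrum T

/-- `(M, N) ∈ Red(T)`: `M` and `N` are closed `T`-invariant subspaces with `X = M ⊕ N`. -/
structure IsRed (T : X →L[ℂ] X) (M N : Submodule ℂ X) : Prop where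
  isClosed_left : IsClosed (M : Set X)
  isClosed_right : IsClosed (N : Set X)
  map_left : ∀ x ∈ M, T x ∈ M
  map_right : ∀ x ∈ N, T x ∈ N
  isCompl : IsCompl M N

/-- The commutant `comm(T)`: all bounded operators that commute with `T`. -/
def comm1 (T : X →L[ℂ] X) : Set (X →L[ℂ] X) := {S | S * T = T * S}

/-- The double commutant `comm²(T)`: all bounded operators that commute with every element
of `comm(T)`. -/
def comm2 (T : X →L[ℂ] X) : Set (X →L[ℂ] X) := {S | ∀ R ∈ comm1 T, S * R = R * S}

/-- `(M, N) ∈ Red²(T)`: the pair `(M, N)` belongs to `Red(S)` for every `S ∈ comm(T)`. -/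
def IsRedSq (T : X →L[ℂ] X) (M N : Submodule ℂ X) : Prop :=
  ∀ S ∈ comm1 T, IsRed S M N

/-- `(M, N) ∈ g^{γ+1}_{σ_*}D(T)`: `(M, N) ∈ Red(T)`, the restriction `T_M` is invertible and
`acc^γ σ_*(T_N) ⊆ {0}`. -/
def IsGDecomp (s : SpectrumKind) (γ : Ordinal) (T : X →L[ℂ] X) (M N : Submodule ℂ X) : Prop :=
  ∃ h : IsRed T M N, IsUnit (T.restrict h.map_left) ∧
    cbDeriv (starSpectrum s (T.restrict h.map_right)) γ ⊆ {0}

/-- `T` is `g^α_{σ_*}`-invertible; the three disjuncts treat `α = 0`, successor ordinals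
`α = γ + 1` and limit ordinals `α` (where some successor ordinal `γ + 1 < α` must work). -/
def IsGInvertible (s : SpectrumKind) (α : Ordinal) (T : X →L[ℂ] X) : Prop :=
  (α = 0 ∧ 0 ∉ starSpectrum s T) ∨
  (∃ γ : Ordinal, α = γ + 1 ∧ ∃ M N : Submodule ℂ X, IsGDecomp s γ T M N) ∨
  (Order.IsSuccLimit α ∧ ∃ γ : Ordinal, γ + 1 < α ∧ ∃ M N : Submodule ℂ X, IsGDecomp s γ T M N)

/-- `Π^{γ+1}_{σ_*}(T) = σ(T) \ acc^γ σ_*(T)`. -/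
noncomputable def specPi (s : SpectrumKind) (γ : Ordinal) (T : X →L[ℂ] X) : Set ℂ :=
  spectrum ℂ T \ cbDeriv (starSpectrum s T) γ

/-- A spectral set of `T`: a subset of `σ(T)` that is clopen in `σ(T)`. -/
def IsSpectralSet (T : X →L[ℂ] X) (A : Set ℂ) : Prop :=
  A ⊆ spectrum ℂ T ∧ IsClopen ((↑) ⁻¹' A : Set (spectrum ℂ T))

end Operators

/-
Let `0 ∉ acc^(γ+1) σ_*(T)`. Accumulation points of `σ(T)` lie in `σ_*(T)`, because on the
generalized kernel of a Drazin invertible operator the operator is nilpotent and modulo that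
kernel it is invertible. A perfect subset of `σ(T)` would survive in every derivative of
`σ_*(T)`, so `σ(T)` is countable near `0` and some circle `|z| = ρ < 1`, inside which `acc^γ
σ_*(T)` is at most `{0}`, avoids it. The Riesz idempotent `P` of this circle and the inverse of
`T` on `ker P`, extended by `0`, lie in `comm²(T)`; they are read off from the Fourier
coefficients of `t ↦ (1 - e^{it} T/ρ)⁻¹`, which needs no contour integration. Conversely `σ_*`,
and with it `acc^γ σ_*`, is the union over the two summands of a reduction of `T`, and a summand
with `acc^γ σ_* ⊆ {0}` disappears at the next derivative.
-/

open Filter Topology Set MeasureTheory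

theorem derivedSet_eq_empty_of_finite {X : Type*} [TopologicalSpace X] [T1Space X] {A : Set X}
    (hA : A.Finite) : derivedSet A = ∅ :=
  eq_empty_of_forall_notMem fun _ hx => Set.Infinite.of_accPt hx hA

section CantorBendixson

variable {A B : Set ℂ}

theorem cbDeriv_mono (h : A ⊆ B) (α : Ordinal) : cbDeriv A α ⊆ cbDeriv B α := by
  induction α using Ordinal.limitRecOn with
  | zero => simpa only [cbDeriv_zero] using h
  | add_one β ih =>
    simp only [cbDeriv_add_one]
    exact derivedSet_mono _ _ ih
  | limit δ hδ ih =>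
    simp only [cbDeriv_limit _ _ hδ]
    exact iInter₂_mono ih

theorem isClosed_cbDeriv (hA : IsClosed A) (α : Ordinal) : IsClosed (cbDeriv A α) := by
  induction α using Ordinal.limitRecOn with
  | zero => rwa [cbDeriv_zero]
  | add_one β _ =>
    rw [cbDeriv_add_one]
    exact isClosed_derivedSet _
  | limit δ hδ ih =>
    rw [cbDeriv_limit _ _ hδ]
    exact isClosed_biInter ih

theorem cbDeriv_add_one_subset (hA : IsClosed A) (α : Ordinal) :
    cbDeriv A (α + 1) ⊆ cbDeriv A α := by
  rw [cbDeriv_add_one]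
  exact (isClosed_iff_derivedSet_subset _).mp (isClosed_cbDeriv hA α)

theorem cbDeriv_antitone (hA : IsClosed A) : Antitone (cbDeriv A) := by
  intro α β h
  induction β using Ordinal.limitRecOn with
  | zero => rw [nonpos_iff_eq_zero.mp h]
  | add_one β ih =>
    rcases h.eq_or_lt with rfl | h
    · exact subset_rfl
    · exact (cbDeriv_add_one_subset hA β).trans (ih (Order.lt_add_one_iff.mp h))
  | limit δ hδ ih =>
    rcases h.eq_or_lt with rfl | h
    · exact subset_rfl
    · rw [cbDeriv_limit _ _ hδ]
      exact biInter_subset_of_mem h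

theorem cbDeriv_subset (hA : IsClosed A) (α : Ordinal) : cbDeriv A α ⊆ A :=
  (cbDeriv_antitone hA (bot_le : 0 ≤ α)).trans (cbDeriv_zero A).subset

theorem cbDeriv_union (hA : IsClosed A) (hB : IsClosed B) (α : Ordinal) :
    cbDeriv (A ∪ B) α = cbDeriv A α ∪ cbDeriv B α := by
  induction α using Ordinal.limitRecOn with
  | zero => simp only [cbDeriv_zero]
  | add_one β ih => simp only [cbDeriv_add_one, ih, derivedSet_union]
  | limit δ hδ ih =>
    refine subset_antisymm (fun x hx => ?_)
      (union_subset (cbDeriv_mono subset_union_left δ) (cbDeriv_mono subset_union_right δ))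
    simp only [cbDeriv_limit _ _ hδ, mem_union, mem_iInter] at hx ⊢
    by_contra! hc
    obtain ⟨⟨a, ha, hxa⟩, ⟨b, hb, hxb⟩⟩ := hc
    have hmax := max_lt ha hb
    rcases (ih _ hmax).subset (hx _ hmax) with h | h
    · exact hxa (cbDeriv_antitone hA (le_max_left a b) h)
    · exact hxb (cbDeriv_antitone hB (le_max_right a b) h)

theorem subset_cbDeriv_of_preperfect (hA : Preperfect A) (h : A ⊆ B) (α : Ordinal) :
    A ⊆ cbDeriv B α := by
  induction α using Ordinal.limitRecOn with
  | zero => rwa [cbDeriv_zero]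
  | add_one β ih =>
    rw [cbDeriv_add_one]
    exact (preperfect_iff_subset_derivedSet.mp hA).trans (derivedSet_mono _ _ ih)
  | limit δ hδ ih =>
    rw [cbDeriv_limit _ _ hδ]
    exact subset_iInter₂ ih

theorem countable_of_finite_cbDeriv_inter {C : Set ℂ} (hC : IsClosed C)
    (hCA : derivedSet C ⊆ A) {γ : Ordinal} (h : (cbDeriv A γ ∩ C).Finite) : C.Countable := by
  by_contra hunc
  obtain ⟨D, hD, hne, hDC⟩ := exists_perfect_nonempty_of_isClosed_of_not_countable hC hunc
  have hDD : D ⊆ derivedSet D := preperfect_iff_subset_derivedSet.mp hD.acc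
  have hDA : D ⊆ A := hDD.trans ((derivedSet_mono _ _ hDC).trans hCA)
  have hfin : D.Finite := h.subset (subset_inter (subset_cbDeriv_of_preperfect hD.acc hDA γ) hDC)
  exact hne.ne_empty (subset_empty_iff.mp (hDD.trans (derivedSet_eq_empty_of_finite hfin).subset))

theorem exists_norm_ne_of_countable {E : Type*} [Norm E] {C : Set E} (hC : C.Countable)
    {r : ℝ} (hr : 0 < r) : ∃ ρ, 0 < ρ ∧ ρ < r ∧ ∀ z ∈ C, ‖z‖ ≠ ρ := by
  obtain ⟨ρ, hρ, h0, hr⟩ := ((hC.image norm).dense_compl ℝ).exists_between hr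
  exact ⟨ρ, h0, hr, fun z hz hzρ => hρ ⟨z, hz, hzρ⟩⟩

/- Near `0` all of `S` is countable, since a perfect subset would survive in every derivative of
`A`; so almost every small circle avoids `S`. -/
theorem exists_sphere_disjoint_of_zero_notMem_cbDeriv {S : Set ℂ} (hS : IsClosed S)
    (hSA : derivedSet S ⊆ A) {γ : Ordinal} (h : 0 ∉ cbDeriv A (γ + 1)) :
    ∃ ρ : ℝ, 0 < ρ ∧ ρ < 1 ∧ (∀ z ∈ S, ‖z‖ ≠ ρ) ∧ ∀ z ∈ cbDeriv A γ, ‖z‖ ≤ ρ → z = 0 := by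
  obtain ⟨r, hr, hball⟩ : ∃ r > 0, ∀ z ∈ cbDeriv A γ, ‖z‖ ≤ r → z = 0 := by
    rw [cbDeriv_add_one, mem_derivedSet, accPt_iff_nhds] at h
    push Not at h
    obtain ⟨U, hU, hUA⟩ := h
    obtain ⟨r, hr, hrU⟩ := Metric.nhds_basis_closedBall.mem_iff.mp hU
    exact ⟨r, hr, fun z hz hzr => hUA z ⟨hrU (mem_closedBall_zero_iff.mpr hzr), hz⟩⟩
  have hcount : (S ∩ Metric.closedBall 0 r).Countable := by
    refine countable_of_finite_cbDeriv_inter (hS.inter Metric.isClosed_closedBall)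
      ((derivedSet_mono _ _ inter_subset_left).trans hSA)
      ((finite_singleton 0).subset fun z hz => hball z hz.1 ?_) (γ := γ)
    exact mem_closedBall_zero_iff.mp hz.2.2
  obtain ⟨ρ, hρ0, hρ, hρS⟩ := exists_norm_ne_of_countable hcount (lt_min hr one_pos)
  obtain ⟨hρr, hρ1⟩ := lt_min_iff.mp hρ
  refine ⟨ρ, hρ0, hρ1, fun z hz hzρ => hρS z ⟨hz, ?_⟩ hzρ, fun z hz hzρ =>
    hball z hz (hzρ.trans hρr.le)⟩
  exact mem_closedBall_zero_iff.mpr (hzρ.trans_le hρr.le)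

end CantorBendixson

theorem commute_ringInverse_right {M₀ : Type*} [MonoidWithZero M₀] {a b : M₀} (h : Commute a b) :
    Commute a (Ring.inverse b) := by
  by_cases hb : IsUnit b
  · obtain ⟨u, rfl⟩ := hb
    rw [Ring.inverse_unit]
    exact h.units_inv_right
  · rw [Ring.inverse_non_unit _ hb]
    exact Commute.zero_right a

section FourierCoefficients

variable {T : ℝ} [hT : Fact (0 < T)] {E : Type*} [NormedAddCommGroup E] [NormedSpace ℂ E]

theorem fourierCoeff_fourier_smul (f : AddCircle T → E) (n k : ℤ) :
    fourierCoeff (fun t => fourier n t • f t) k = fourierCoeff f (k - n) := by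
  simp only [fourierCoeff, smul_smul, ← fourier_add, neg_sub, neg_add_eq_sub]

theorem tendsto_fourierCoeff_cofinite (f : AddCircle T → E) :
    Tendsto (fourierCoeff f) cofinite (𝓝 0) := by
  have hT0 : T⁻¹ ≠ 0 := inv_ne_zero hT.out.ne'
  have h := (((Real.tendsto_integral_exp_smul_cocompact
    ((Ioc 0 T).indicator fun t : ℝ => f t)).comp (Filter.tendsto_cocompact_mul_right₀ hT0)).comp
      Int.tendsto_coe_cofinite).const_smul (1 / T)
  rw [smul_zero] at h
  refine h.congr fun k => ?_
  rw [fourierCoeff_eq_intervalIntegral f k 0, zero_add,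
    intervalIntegral.integral_of_le hT.out.le, ← integral_indicator measurableSet_Ioc]
  refine congrArg _ (integral_congr_ae (.of_forall fun t => ?_))
  by_cases ht : t ∈ Ioc 0 T
  · simp only [indicator_of_mem ht, Circle.smul_def, fourier_coe_apply,
      Real.fourierChar_apply]
    congr 2
    push_cast
    ring
  · simp [ht]

theorem fourierCoeff_const [CompleteSpace E] (v : E) (k : ℤ) :
    fourierCoeff (fun _ : AddCircle T => v) k = if k = 0 then v else 0 := by
  have h := congrFun (fourierCoeff_fourier (T := T) 0) k
  simp only [fourierCoeff, fourier_zero, smul_eq_mul, mul_one, Pi.single_apply] at h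
  rw [fourierCoeff, integral_smul_const, h, ite_smul, one_smul, zero_smul]

variable {A : Type*} [NormedRing A] [NormedAlgebra ℂ A] {f : AddCircle T → A}

theorem fourierCoeff_mul_left (hf : Integrable f AddCircle.haarAddCircle) (a : A) (k : ℤ) :
    fourierCoeff (fun t => a * f t) k = a * fourierCoeff f k := by
  simp only [fourierCoeff, ← mul_smul_comm]
  exact integral_const_mul_of_integrable (hf.fourier_smul (-k))

theorem fourierCoeff_mul_right (hf : Integrable f AddCircle.haarAddCircle) (a : A) (k : ℤ) :
    fourierCoeff (fun t => f t * a) k = fourierCoeff f k * a := by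
  simp only [fourierCoeff, ← smul_mul_assoc]
  exact integral_mul_const_of_integrable (hf.fourier_smul (-k))

end FourierCoefficients

section RieszIdempotent

variable {A : Type*} [NormedRing A] [NormedAlgebra ℂ A] {a : A}

/-- The function `u ↦ (1 - u a)⁻¹` on the unit circle, parametrized by `ℝ / ℤ`; it takes the junk
value `0` at those `u` for which `1 - u a` is not invertible. -/
noncomputable def circleResolvent (a : A) (t : UnitAddCircle) : A :=
  Ring.inverse (1 - fourier 1 t • a)

theorem isUnit_one_sub_smul {u : ℂ} (hu : u ≠ 0) (h : u⁻¹ ∉ spectrum ℂ a) :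
    IsUnit (1 - u • a) := by
  rw [spectrum.notMem_iff] at h
  simpa [Units.smul_def, smul_sub, Algebra.algebraMap_eq_smul_one, smul_smul, hu] using
    h.smul (Units.mk0 u hu)

theorem isUnit_one_sub_fourier_smul (ha : ∀ z ∈ spectrum ℂ a, ‖z‖ ≠ 1) (t : UnitAddCircle) :
    IsUnit (1 - fourier 1 t • a) :=
  isUnit_one_sub_smul (Circle.coe_ne_zero _) fun h =>
    ha _ h (by rw [norm_inv, fourier_apply, Circle.norm_coe, inv_one])

theorem commute_circleResolvent {b : A} (hb : Commute b a) (t : UnitAddCircle) :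
    Commute b (circleResolvent a t) :=
  commute_ringInverse_right ((Commute.one_right b).sub_right (hb.smul_right _))

theorem circleResolvent_eq (ha : ∀ z ∈ spectrum ℂ a, ‖z‖ ≠ 1) (t : UnitAddCircle) :
    circleResolvent a t = 1 + fourier 1 t • (a * circleResolvent a t) := by
  have h := Ring.mul_inverse_cancel _ (isUnit_one_sub_fourier_smul ha t)
  rwa [sub_mul, one_mul, smul_mul_assoc, sub_eq_iff_eq_add] at h

variable [CompleteSpace A]

theorem continuous_circleResolvent (ha : ∀ z ∈ spectrum ℂ a, ‖z‖ ≠ 1) :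
    Continuous (circleResolvent a) := by
  refine continuous_iff_continuousAt.mpr fun t => ?_
  obtain ⟨u, hu⟩ := isUnit_one_sub_fourier_smul ha t
  have hinv := hu ▸ NormedRing.inverse_continuousAt u
  exact hinv.comp (f := fun t : UnitAddCircle => 1 - fourier 1 t • a)
    (continuous_const.sub ((map_continuous (fourier 1)).smul continuous_const)).continuousAt

theorem integrable_circleResolvent (ha : ∀ z ∈ spectrum ℂ a, ‖z‖ ≠ 1) :
    Integrable (circleResolvent a) AddCircle.haarAddCircle :=
  (continuous_circleResolvent ha).integrable_of_hasCompactSupport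
    (HasCompactSupport.of_compactSpace _)

theorem commute_fourierCoeff_circleResolvent (ha : ∀ z ∈ spectrum ℂ a, ‖z‖ ≠ 1) {b : A}
    (hb : Commute b a) (k : ℤ) : Commute b (fourierCoeff (circleResolvent a) k) := by
  have hint := integrable_circleResolvent ha
  rw [commute_iff_eq, ← fourierCoeff_mul_left hint, ← fourierCoeff_mul_right hint]
  simp only [(commute_circleResolvent hb _).eq]

theorem fourierCoeff_circleResolvent (ha : ∀ z ∈ spectrum ℂ a, ‖z‖ ≠ 1) (k : ℤ) :
    fourierCoeff (circleResolvent a) k =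
      (if k = 0 then 1 else 0) + a * fourierCoeff (circleResolvent a) (k - 1) := by
  have hint := integrable_circleResolvent ha
  have h := congrFun (fourierCoeff.add (integrable_const (1 : A))
    ((hint.const_mul a).fourier_smul 1)) k
  rw [Pi.add_apply, fourierCoeff_const, fourierCoeff_fourier_smul,
    fourierCoeff_mul_left hint] at h
  rw [← h]
  exact congrArg (fourierCoeff · k) (funext (circleResolvent_eq ha))

theorem fourierCoeff_circleResolvent_natCast (ha : ∀ z ∈ spectrum ℂ a, ‖z‖ ≠ 1) (n : ℕ) :
    fourierCoeff (circleResolvent a) n = a ^ n * fourierCoeff (circleResolvent a) 0 := by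
  induction n with
  | zero => simp
  | succ n ih =>
    rw [Nat.cast_succ, fourierCoeff_circleResolvent ha, if_neg (by positivity), zero_add,
      add_sub_cancel_right, ih, ← mul_assoc, ← pow_succ']

theorem fourierCoeff_circleResolvent_neg_one (ha : ∀ z ∈ spectrum ℂ a, ‖z‖ ≠ 1) (n : ℕ) :
    fourierCoeff (circleResolvent a) (-1) =
      a ^ n * fourierCoeff (circleResolvent a) (-1 - n) := by
  induction n with
  | zero => simp
  | succ n ih =>
    rw [ih, fourierCoeff_circleResolvent ha, if_neg (by omega), zero_add, ← mul_assoc,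
      ← pow_succ, Nat.cast_succ, sub_sub]

/- `c₀ c₋₁ = cₙ c₋₁₋ₙ` for every `n`, and the right side tends to `0` by the Riemann-Lebesgue
lemma. -/
theorem fourierCoeff_circleResolvent_zero_mul_neg_one (ha : ∀ z ∈ spectrum ℂ a, ‖z‖ ≠ 1) :
    fourierCoeff (circleResolvent a) 0 * fourierCoeff (circleResolvent a) (-1) = 0 := by
  have hlim : Tendsto (fun n : ℕ => fourierCoeff (circleResolvent a) n *
      fourierCoeff (circleResolvent a) (-1 - n)) cofinite (𝓝 (0 * 0)) :=
    ((tendsto_fourierCoeff_cofinite _).comp (Nat.cast_injective (R := ℤ)).tendsto_cofinite).mul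
      ((tendsto_fourierCoeff_cofinite _).comp
        (sub_right_injective.comp (Nat.cast_injective (R := ℤ))).tendsto_cofinite)
  rw [mul_zero] at hlim
  refine tendsto_nhds_unique (tendsto_const_nhds.congr fun n => ?_) hlim
  have hcomm := (commute_fourierCoeff_circleResolvent ha (Commute.refl a) 0).pow_left n
  rw [fourierCoeff_circleResolvent_natCast ha n, fourierCoeff_circleResolvent_neg_one ha n,
    ← mul_assoc, hcomm.eq]

theorem isIdempotentElem_fourierCoeff_circleResolvent (ha : ∀ z ∈ spectrum ℂ a, ‖z‖ ≠ 1) :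
    IsIdempotentElem (fourierCoeff (circleResolvent a) 0) := by
  have hcomm := commute_fourierCoeff_circleResolvent ha (Commute.refl a) 0
  have h0 := fourierCoeff_circleResolvent ha 0
  rw [if_pos rfl, zero_sub] at h0
  rw [IsIdempotentElem]
  nth_rw 2 [h0]
  rw [mul_add, mul_one, ← mul_assoc, ← hcomm.eq, mul_assoc,
    fourierCoeff_circleResolvent_zero_mul_neg_one ha, mul_zero, add_zero]

theorem norm_lt_one_of_tendsto_pow {b : A} (hb : Tendsto (b ^ ·) atTop (𝓝 0)) {z : ℂ}
    (hz : z ∈ spectrum ℂ b) : ‖z‖ < 1 := by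
  have hle (n : ℕ) : ‖z‖ ^ n ≤ ‖b ^ n‖ * ‖(1 : A)‖ := by
    rw [← norm_pow]
    exact spectrum.norm_le_norm_mul_of_mem (spectrum.pow_mem_pow b n hz)
  have hlim : Tendsto (‖z‖ ^ ·) atTop (𝓝 0) :=
    squeeze_zero (fun n => by positivity) hle (by simpa using hb.norm.mul_const ‖(1 : A)‖)
  by_contra! hz1
  exact absurd (ge_of_tendsto' hlim fun n => one_le_pow₀ hz1) (by norm_num)

theorem exists_sq_mul_eq_self_of_norm_ne_one (ha : ∀ z ∈ spectrum ℂ a, ‖z‖ ≠ 1) :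
    ∃ s : A, (∀ c, Commute c a → Commute c s) ∧ s ^ 2 * a = s ∧
      ∀ z ∈ spectrum ℂ (a - a ^ 2 * s), ‖z‖ < 1 := by
  set p := fourierCoeff (circleResolvent a) 0 with hp_def
  set b := -fourierCoeff (circleResolvent a) (-1) with hb_def
  have hp : IsIdempotentElem p := isIdempotentElem_fourierCoeff_circleResolvent ha
  have hcp (c : A) (hc : Commute c a) : Commute c p := commute_fourierCoeff_circleResolvent ha hc 0
  have hcb (c : A) (hc : Commute c a) : Commute c b :=
    (commute_fourierCoeff_circleResolvent ha hc (-1)).neg_right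
  have hab : a * b = 1 - p := by
    rw [hp_def, fourierCoeff_circleResolvent ha, if_pos rfl, zero_sub, hb_def, mul_neg,
      sub_add_cancel_left]
  have has : a * (b * (1 - p)) = 1 - p := by rw [← mul_assoc, hab, hp.one_sub.eq]
  have hcs (c : A) (hc : Commute c a) : Commute c (b * (1 - p)) :=
    (hcb c hc).mul_right ((Commute.one_right c).sub_right (hcp c hc))
  refine ⟨b * (1 - p), hcs, ?_, fun z hz => norm_lt_one_of_tendsto_pow ?_ hz⟩
  · rw [sq, mul_assoc, ← (hcs a (Commute.refl a)).eq, has, mul_assoc, hp.one_sub.eq]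
  · have hlim := (tendsto_fourierCoeff_cofinite (circleResolvent a)).comp
      (Nat.cast_injective (R := ℤ)).tendsto_cofinite
    rw [Nat.cofinite_eq_atTop] at hlim
    refine hlim.congr' ((eventually_ne_atTop 0).mono fun n hn => ?_)
    change fourierCoeff (circleResolvent a) n = (_ : A) ^ n
    rw [fourierCoeff_circleResolvent_natCast ha, ← hp_def, sq, mul_assoc, has,
      mul_sub, mul_one, sub_sub_cancel, (hcp a (Commute.refl a)).mul_pow, hp.pow_eq hn]

theorem exists_sq_mul_eq_self_of_norm_ne {ρ : ℝ} (hρ : 0 < ρ) (ha : ∀ z ∈ spectrum ℂ a, ‖z‖ ≠ ρ) :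
    ∃ s : A, (∀ c, Commute c a → Commute c s) ∧ s ^ 2 * a = s ∧
      ∀ z ∈ spectrum ℂ (a - a ^ 2 * s), ‖z‖ < ρ := by
  obtain ⟨u, hu⟩ : ∃ u : ℂˣ, (u : ℂ) = ρ := ⟨Units.mk0 ρ (by simp [hρ.ne']), rfl⟩
  have hnorm (z : ℂ) : ‖u • z‖ = ρ * ‖z‖ := by simp [Units.smul_def, hu, abs_of_pos hρ]
  have hua : ∀ z ∈ spectrum ℂ (u⁻¹ • a), ‖z‖ ≠ 1 := fun z hz hz1 => by
    refine ha (u • z) ?_ (by rw [hnorm, hz1, mul_one])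
    simpa only [smul_inv_smul] using (spectrum.smul_mem_smul_iff (r := u)).mpr hz
  obtain ⟨s, hcs, hsq, hspec⟩ := exists_sq_mul_eq_self_of_norm_ne_one hua
  refine ⟨u⁻¹ • s, fun c hc => (hcs c (hc.smul_right _)).smul_right _, ?_, fun z hz => ?_⟩
  · rw [sq, smul_mul_smul, ← sq, smul_mul_assoc, sq u⁻¹, mul_smul, ← mul_smul_comm, ← sq, hsq]
  · have h := hspec (u⁻¹ • z) ?_
    · rwa [← mul_lt_mul_iff_right₀ hρ, ← hnorm, smul_inv_smul, mul_one] at h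
    · convert (spectrum.smul_mem_smul_iff (r := u⁻¹)).mpr hz using 1
      rw [smul_sub, smul_pow, mul_smul_comm, smul_mul_assoc, sq u⁻¹, mul_smul]

end RieszIdempotent

section CommutingOuterInverse

variable {R : Type*} [Ring R] {a b p s : R}

theorem mul_one_sub_add_mul_eq_one (hp : IsIdempotentElem p) (hbp : Commute b p)
    (hab : a * b = 1 - p) : (a * (1 - p) + p) * (b * (1 - p) + p) = 1 :=
  calc
    _ = a * ((1 - p) * b) * (1 - p) + a * ((1 - p) * p) + p * b * (1 - p) + p * p := by
      noncomm_ring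
    _ = a * b * ((1 - p) * (1 - p)) + a * ((1 - p) * p) + b * (p * (1 - p)) + p * p := by
      rw [← ((Commute.one_right b).sub_right hbp).eq, ← hbp.eq, ← mul_assoc a b, mul_assoc (a * b),
        mul_assoc b p]
    _ = 1 := by
      rw [hab, hp.one_sub_mul_self, hp.mul_one_sub_self, hp.one_sub.eq, hp.one_sub.eq, hp.eq,
        mul_zero, mul_zero, add_zero, add_zero, sub_add_cancel]

theorem isUnit_mul_one_sub_add (hp : IsIdempotentElem p) (hap : Commute a p) (hbp : Commute b p)
    (hba : Commute b a) (hab : a * b = 1 - p) : IsUnit (a * (1 - p) + p) :=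
  isUnit_iff_exists.mpr ⟨b * (1 - p) + p, mul_one_sub_add_mul_eq_one hp hbp hab,
    mul_one_sub_add_mul_eq_one hp hap (hba.eq.trans hab)⟩

theorem isUnit_add_of_isUnit_one_add_mul (hp : IsIdempotentElem p) (hap : Commute a p)
    (ha : IsUnit (a * (1 - p) + p)) (h : IsUnit (1 + a * p)) : IsUnit (a + p) := by
  have hmul : (a * (1 - p) + p) * (1 + a * p) = a + p :=
    calc
      _ = a * (1 - p) + p + a * ((1 - p) * (a * p)) + p * (a * p) := by noncomm_ring
      _ = a * (1 - p) + p + a * ((1 - p) * p * a) + p * p * a := by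
        rw [hap.eq, mul_assoc (1 - p), mul_assoc p p]
      _ = a + p := by
        rw [hp.one_sub_mul_self, hp.eq, ← hap.eq, zero_mul, mul_zero, add_zero, add_right_comm,
          ← mul_add, sub_add_cancel, mul_one]
  exact hmul ▸ ha.mul h

theorem commute_one_sub_mul {c : R} (hca : Commute c a) (hcs : Commute c s) :
    Commute c (1 - a * s) :=
  (Commute.one_right c).sub_right (hca.mul_right hcs)

theorem isIdempotentElem_one_sub_mul (hs : Commute s a) (h : s ^ 2 * a = s) :
    IsIdempotentElem (1 - a * s) := by
  have hsas : s * (a * s) = s := by rw [← hs.eq, ← mul_assoc, ← sq, h]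
  refine IsIdempotentElem.one_sub ?_
  rw [IsIdempotentElem, mul_assoc, hsas]

theorem isUnit_mul_mul_add_one_sub_mul (hs : Commute s a) (h : s ^ 2 * a = s) :
    IsUnit (a * (a * s) + (1 - a * s)) := by
  simpa only [sub_sub_cancel] using isUnit_mul_one_sub_add (isIdempotentElem_one_sub_mul hs h)
    (commute_one_sub_mul (Commute.refl a) hs.symm) (commute_one_sub_mul hs (Commute.refl s)) hs
    (sub_sub_cancel 1 (a * s)).symm

theorem sub_sq_mul (a s : R) : a - a ^ 2 * s = a * (1 - a * s) := by
  rw [mul_sub, mul_one, ← mul_assoc, sq]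

end CommutingOuterInverse

section Splitting

variable {X M N : Type*} [NormedAddCommGroup X] [NormedSpace ℂ X]
  [NormedAddCommGroup M] [NormedSpace ℂ M] [NormedAddCommGroup N] [NormedSpace ℂ N]

/-- The operator `A` on `M` is a direct summand of the operator `T` on `X`, with inclusion `i` and
projection `p`. Working with arbitrary spaces `M` instead of subspaces of `X` keeps restrictions of
equal operators to equal subspaces interchangeable. -/
structure IsSummand (T : X →L[ℂ] X) (A : M →L[ℂ] M) (i : M →L[ℂ] X) (p : X →L[ℂ] M) : Prop where
  proj_incl : ∀ m, p (i m) = m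
  map_incl : ∀ m, T (i m) = i (A m)
  proj_map : ∀ x, p (T x) = A (p x)

/-- The operator `T` is the direct sum of the operators `A` and `B`, with inclusions `i`, `j` and
projections `p`, `q`. -/
structure IsDirectSum (T : X →L[ℂ] X) (A : M →L[ℂ] M) (B : N →L[ℂ] N)
    (i : M →L[ℂ] X) (p : X →L[ℂ] M) (j : N →L[ℂ] X) (q : X →L[ℂ] N) : Prop where
  left : IsSummand T A i p
  right : IsSummand T B j q
  sum : ∀ x, i (p x) + j (q x) = x

/-- The regularity condition on `T` whose failure for `T - z` defines `z ∈ σ_*(T)`: being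
invertible, Browder or Drazin invertible. -/
def IsStarRegular (s : SpectrumKind) (T : X →L[ℂ] X) : Prop :=
  match s with
  | SpectrumKind.ordinary => IsUnit T
  | SpectrumKind.browder => IsBrowder T
  | SpectrumKind.drazin => IsDrazinInvertible T

variable {T : X →L[ℂ] X} {A : M →L[ℂ] M} {B : N →L[ℂ] N}
  {i : M →L[ℂ] X} {p : X →L[ℂ] M} {j : N →L[ℂ] X} {q : X →L[ℂ] N} {s : SpectrumKind} {z : ℂ}

theorem mem_spectrum_iff_not_isUnit_sub_smul_one {A : Type*} [Ring A] [Algebra ℂ A] {a : A} :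
    z ∈ spectrum ℂ a ↔ ¬ IsUnit (a - z • (1 : A)) := by
  rw [spectrum.mem_iff, ← IsUnit.neg_iff, neg_sub, Algebra.algebraMap_eq_smul_one]

theorem mem_starSpectrum : z ∈ starSpectrum s T ↔ ¬ IsStarRegular s (T - z • (1 : X →L[ℂ] X)) := by
  cases s with
  | ordinary => exact mem_spectrum_iff_not_isUnit_sub_smul_one
  | browder => rfl
  | drazin => rfl

theorem hasFiniteAscent_iff_eventually :
    HasFiniteAscent T ↔ ∀ᶠ n in atTop, ∀ x, (T ^ (n + 1)) x = 0 → (T ^ n) x = 0 := by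
  constructor
  · rintro ⟨n, hn⟩
    filter_upwards [eventually_ge_atTop n] with m hm x hx
    obtain ⟨k, rfl⟩ := Nat.exists_eq_add_of_le hm
    rw [pow_add, mul_apply_eq_comp]
    rw [add_right_comm, pow_add, mul_apply_eq_comp] at hx
    exact hn.ge hx
  · intro h
    obtain ⟨n, hn⟩ := h.exists
    refine ⟨n, le_antisymm (fun x (hx : (T ^ n) x = 0) => ?_) hn⟩
    change (T ^ (n + 1)) x = 0
    rw [pow_succ', mul_apply_eq_comp, hx, map_zero]

theorem hasFiniteDescent_iff_eventually :
    HasFiniteDescent T ↔ ∀ᶠ n in atTop, ∀ x, ∃ y, (T ^ (n + 1)) y = (T ^ n) x := by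
  constructor
  · rintro ⟨n, hn⟩
    filter_upwards [eventually_ge_atTop n] with m hm x
    obtain ⟨k, rfl⟩ := Nat.exists_eq_add_of_le' hm
    obtain ⟨y, hy⟩ : ∃ y, (T ^ (n + 1)) y = (T ^ n) x := hn.le ⟨x, rfl⟩
    exact ⟨y, by rw [add_assoc, pow_add, mul_apply_eq_comp, hy, pow_add, mul_apply_eq_comp]⟩
  · intro h
    obtain ⟨n, hn⟩ := h.exists
    refine ⟨n, le_antisymm ?_ ?_⟩
    · rintro _ ⟨x, rfl⟩
      exact hn x
    · rintro _ ⟨x, rfl⟩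
      exact ⟨T x, by simp [pow_succ]⟩

theorem isDrazinInvertible_of_isUnit (h : IsUnit T) : IsDrazinInvertible T := by
  refine ⟨hasFiniteAscent_iff_eventually.mpr (.of_forall fun n x hx => ?_),
    hasFiniteDescent_iff_eventually.mpr (.of_forall fun n x => ?_)⟩
  · obtain ⟨V, -, hVT⟩ := isUnit_iff_exists.mp h
    have hVx : (T ^ n) x = V (T ((T ^ n) x)) := (DFunLike.congr_fun hVT ((T ^ n) x)).symm
    rwa [← mul_apply_eq_comp T, ← pow_succ', hx, map_zero] at hVx
  · obtain ⟨V, hTV, -⟩ := isUnit_iff_exists.mp h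
    exact ⟨V x, by rw [pow_succ, mul_apply_eq_comp, ← mul_apply_eq_comp T, hTV, one_apply_eq_self]⟩

theorem isFredholm_iff_exists_hasNoetherianRange : T.IsFredholm ↔ ∃ V : X →L[ℂ] X,
    ((V * T - 1 : X →L[ℂ] X) : X →ₗ[ℂ] X).HasNoetherianRange ∧
      ((T * V - 1 : X →L[ℂ] X) : X →ₗ[ℂ] X).HasNoetherianRange := by
  rw [ContinuousLinearMap.isFredholm_iff_exists_isQuasiInverse]
  exact exists_congr fun V =>
    and_congr LinearMap.FiniteRangeSetoid.equiv_iff_hasNoetherianRange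
      LinearMap.FiniteRangeSetoid.equiv_iff_hasNoetherianRange

theorem isFredholm_of_isUnit (h : IsUnit T) : T.IsFredholm := by
  obtain ⟨V, hTV, hVT⟩ := isUnit_iff_exists.mp h
  exact isFredholm_iff_exists_hasNoetherianRange.mpr ⟨V, by simp [hVT], by simp [hTV]⟩

theorem isStarRegular_of_isUnit (h : IsUnit T) (s : SpectrumKind) : IsStarRegular s T := by
  cases s with
  | ordinary => exact h
  | browder => exact ⟨isFredholm_of_isUnit h, isDrazinInvertible_of_isUnit h⟩
  | drazin => exact isDrazinInvertible_of_isUnit h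

theorem IsStarRegular.isDrazinInvertible (h : IsStarRegular s T) : IsDrazinInvertible T := by
  cases s with
  | ordinary => exact isDrazinInvertible_of_isUnit h
  | browder => exact h.2
  | drazin => exact h

theorem starSpectrum_subset_spectrum (s : SpectrumKind) (T : X →L[ℂ] X) :
    starSpectrum s T ⊆ spectrum ℂ T := fun _ hz =>
  mem_spectrum_iff_not_isUnit_sub_smul_one.mpr fun h =>
    mem_starSpectrum.mp hz (isStarRegular_of_isUnit h s)

namespace IsSummand

theorem sub_smul_one (h : IsSummand T A i p) (z : ℂ) :
    IsSummand (T - z • (1 : X →L[ℂ] X)) (A - z • (1 : M →L[ℂ] M)) i p where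
  proj_incl := h.proj_incl
  map_incl m := by simp [h.map_incl]
  proj_map x := by simp [h.proj_map]

theorem map_incl_pow (h : IsSummand T A i p) (n : ℕ) (m : M) :
    (T ^ n) (i m) = i ((A ^ n) m) := by
  induction n generalizing m with
  | zero => simp
  | succ n ih => rw [pow_succ, pow_succ, mul_apply_eq_comp, mul_apply_eq_comp, h.map_incl, ih]

theorem proj_map_pow (h : IsSummand T A i p) (n : ℕ) (x : X) :
    p ((T ^ n) x) = (A ^ n) (p x) := by
  induction n generalizing x with
  | zero => simp
  | succ n ih => rw [pow_succ, pow_succ, mul_apply_eq_comp, mul_apply_eq_comp, ih, h.proj_map]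

theorem hasFiniteAscent (h : IsSummand T A i p) (hT : HasFiniteAscent T) : HasFiniteAscent A := by
  rw [hasFiniteAscent_iff_eventually] at hT ⊢
  filter_upwards [hT] with n hn m hm
  rw [← h.proj_incl ((A ^ n) m), ← h.map_incl_pow,
    hn (i m) (by rw [h.map_incl_pow, hm, map_zero]), map_zero]

theorem hasFiniteDescent (h : IsSummand T A i p) (hT : HasFiniteDescent T) :
    HasFiniteDescent A := by
  rw [hasFiniteDescent_iff_eventually] at hT ⊢
  filter_upwards [hT] with n hn m
  obtain ⟨y, hy⟩ := hn (i m)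
  exact ⟨p y, by rw [← h.proj_map_pow, hy, h.proj_map_pow, h.proj_incl]⟩

theorem isFredholm (h : IsSummand T A i p) (hT : T.IsFredholm) : A.IsFredholm := by
  rw [isFredholm_iff_exists_hasNoetherianRange] at hT ⊢
  obtain ⟨V, h1, h2⟩ := hT
  have e1 : ((p ∘L V ∘L i * A - 1 : M →L[ℂ] M) : M →ₗ[ℂ] M) =
      (p : X →ₗ[ℂ] M) ∘ₗ ((V * T - 1 : X →L[ℂ] X) : X →ₗ[ℂ] X) ∘ₗ (i : M →ₗ[ℂ] X) :=
    LinearMap.ext fun m => by simp [h.map_incl, h.proj_incl]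
  have e2 : ((A * p ∘L V ∘L i - 1 : M →L[ℂ] M) : M →ₗ[ℂ] M) =
      (p : X →ₗ[ℂ] M) ∘ₗ ((T * V - 1 : X →L[ℂ] X) : X →ₗ[ℂ] X) ∘ₗ (i : M →ₗ[ℂ] X) :=
    LinearMap.ext fun m => by simp [h.proj_map, h.proj_incl]
  refine ⟨p ∘L V ∘L i, ?_, ?_⟩
  · rw [e1]
    exact (h1.comp_right _).comp_left _
  · rw [e2]
    exact (h2.comp_right _).comp_left _

theorem isUnit (h : IsSummand T A i p) (hT : IsUnit T) : IsUnit A := by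
  obtain ⟨V, hTV, hVT⟩ := isUnit_iff_exists.mp hT
  refine isUnit_iff_exists.mpr ⟨p ∘L V ∘L i, ContinuousLinearMap.ext fun m => ?_,
    ContinuousLinearMap.ext fun m => ?_⟩
  · change A (p (V (i m))) = m
    rw [← h.proj_map, ← mul_apply_eq_comp, hTV, one_apply_eq_self, h.proj_incl]
  · change p (V (i (A m))) = m
    rw [← h.map_incl, ← mul_apply_eq_comp, hVT, one_apply_eq_self, h.proj_incl]

theorem isStarRegular (h : IsSummand T A i p) (hT : IsStarRegular s T) :
    IsStarRegular s A := by
  cases s with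
  | ordinary => exact h.isUnit hT
  | browder => exact ⟨h.isFredholm hT.1, h.hasFiniteAscent hT.2.1, h.hasFiniteDescent hT.2.2⟩
  | drazin => exact ⟨h.hasFiniteAscent hT.1, h.hasFiniteDescent hT.2⟩

theorem starSpectrum_subset (h : IsSummand T A i p) (s : SpectrumKind) :
    starSpectrum s A ⊆ starSpectrum s T := fun z hz => by
  rw [mem_starSpectrum] at hz ⊢
  exact fun hT => hz ((h.sub_smul_one z).isStarRegular hT)

end IsSummand

namespace IsDirectSum

theorem sub_smul_one (h : IsDirectSum T A B i p j q) (z : ℂ) :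
    IsDirectSum (T - z • (1 : X →L[ℂ] X)) (A - z • (1 : M →L[ℂ] M)) (B - z • (1 : N →L[ℂ] N))
      i p j q :=
  ⟨h.left.sub_smul_one z, h.right.sub_smul_one z, h.sum⟩

theorem hasFiniteAscent (h : IsDirectSum T A B i p j q) (hA : HasFiniteAscent A)
    (hB : HasFiniteAscent B) : HasFiniteAscent T := by
  rw [hasFiniteAscent_iff_eventually] at hA hB ⊢
  filter_upwards [hA, hB] with n hAn hBn x hx
  have hp : (A ^ n) (p x) = 0 := hAn _ (by rw [← h.left.proj_map_pow, hx, map_zero])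
  have hq : (B ^ n) (q x) = 0 := hBn _ (by rw [← h.right.proj_map_pow, hx, map_zero])
  rw [← h.sum ((T ^ n) x), h.left.proj_map_pow, h.right.proj_map_pow, hp, hq, map_zero, map_zero,
    add_zero]

theorem hasFiniteDescent (h : IsDirectSum T A B i p j q) (hA : HasFiniteDescent A)
    (hB : HasFiniteDescent B) : HasFiniteDescent T := by
  rw [hasFiniteDescent_iff_eventually] at hA hB ⊢
  filter_upwards [hA, hB] with n hAn hBn x
  obtain ⟨y, hy⟩ := hAn (p x)
  obtain ⟨y', hy'⟩ := hBn (q x)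
  refine ⟨i y + j y', ?_⟩
  rw [← h.sum ((T ^ n) x), h.left.proj_map_pow, h.right.proj_map_pow, map_add,
    h.left.map_incl_pow, h.right.map_incl_pow, hy, hy']

theorem isFredholm (h : IsDirectSum T A B i p j q) (hA : A.IsFredholm) (hB : B.IsFredholm) :
    T.IsFredholm := by
  rw [isFredholm_iff_exists_hasNoetherianRange] at hA hB ⊢
  obtain ⟨V, h1, h2⟩ := hA
  obtain ⟨W, h3, h4⟩ := hB
  have e1 : (((i ∘L V ∘L p + j ∘L W ∘L q) * T - 1 : X →L[ℂ] X) : X →ₗ[ℂ] X) =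
      (i : M →ₗ[ℂ] X) ∘ₗ ((V * A - 1 : M →L[ℂ] M) : M →ₗ[ℂ] M) ∘ₗ (p : X →ₗ[ℂ] M) +
      (j : N →ₗ[ℂ] X) ∘ₗ ((W * B - 1 : N →L[ℂ] N) : N →ₗ[ℂ] N) ∘ₗ (q : X →ₗ[ℂ] N) :=
    LinearMap.ext fun x => by
      change i (V (p (T x))) + j (W (q (T x))) - x =
        i (V (A (p x)) - p x) + j (W (B (q x)) - q x)
      rw [h.left.proj_map, h.right.proj_map, map_sub, map_sub, sub_add_sub_comm, h.sum]
  have e2 : ((T * (i ∘L V ∘L p + j ∘L W ∘L q) - 1 : X →L[ℂ] X) : X →ₗ[ℂ] X) =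
      (i : M →ₗ[ℂ] X) ∘ₗ ((A * V - 1 : M →L[ℂ] M) : M →ₗ[ℂ] M) ∘ₗ (p : X →ₗ[ℂ] M) +
      (j : N →ₗ[ℂ] X) ∘ₗ ((B * W - 1 : N →L[ℂ] N) : N →ₗ[ℂ] N) ∘ₗ (q : X →ₗ[ℂ] N) :=
    LinearMap.ext fun x => by
      change T (i (V (p x)) + j (W (q x))) - x =
        i (A (V (p x)) - p x) + j (B (W (q x)) - q x)
      rw [map_add, h.left.map_incl, h.right.map_incl, map_sub, map_sub, sub_add_sub_comm, h.sum]
  refine ⟨i ∘L V ∘L p + j ∘L W ∘L q, ?_, ?_⟩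
  · rw [e1]
    exact ((h1.comp_right _).comp_left _).add ((h3.comp_right _).comp_left _)
  · rw [e2]
    exact ((h2.comp_right _).comp_left _).add ((h4.comp_right _).comp_left _)

theorem isUnit (h : IsDirectSum T A B i p j q) (hA : IsUnit A) (hB : IsUnit B) : IsUnit T := by
  obtain ⟨V, hAV, hVA⟩ := isUnit_iff_exists.mp hA
  obtain ⟨W, hBW, hWB⟩ := isUnit_iff_exists.mp hB
  refine isUnit_iff_exists.mpr ⟨i ∘L V ∘L p + j ∘L W ∘L q, ContinuousLinearMap.ext fun x => ?_,
    ContinuousLinearMap.ext fun x => ?_⟩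
  · change T (i (V (p x)) + j (W (q x))) = x
    rw [map_add, h.left.map_incl, h.right.map_incl, ← mul_apply_eq_comp A, ← mul_apply_eq_comp B,
      hAV, hBW, one_apply_eq_self, one_apply_eq_self, h.sum]
  · change i (V (p (T x))) + j (W (q (T x))) = x
    rw [h.left.proj_map, h.right.proj_map, ← mul_apply_eq_comp V, ← mul_apply_eq_comp W,
      hVA, hWB, one_apply_eq_self, one_apply_eq_self, h.sum]

theorem isStarRegular (h : IsDirectSum T A B i p j q)
    (hA : IsStarRegular s A) (hB : IsStarRegular s B) : IsStarRegular s T := by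
  cases s with
  | ordinary => exact h.isUnit hA hB
  | browder =>
    exact ⟨h.isFredholm hA.1 hB.1, h.hasFiniteAscent hA.2.1 hB.2.1,
      h.hasFiniteDescent hA.2.2 hB.2.2⟩
  | drazin => exact ⟨h.hasFiniteAscent hA.1 hB.1, h.hasFiniteDescent hA.2 hB.2⟩

theorem starSpectrum_eq (h : IsDirectSum T A B i p j q) (s : SpectrumKind) :
    starSpectrum s T = starSpectrum s A ∪ starSpectrum s B := by
  refine subset_antisymm (fun z hz => ?_)
    (union_subset (h.left.starSpectrum_subset s) (h.right.starSpectrum_subset s))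
  by_contra hc
  rw [mem_union, mem_starSpectrum, mem_starSpectrum] at hc
  push Not at hc
  exact mem_starSpectrum.mp hz ((h.sub_smul_one z).isStarRegular hc.1 hc.2)

end IsDirectSum

end Splitting

section IsolatedPoints

theorem eventually_isUnit_sub_smul_one {A : Type*} [NormedRing A] [NormedAlgebra ℂ A]
    [CompleteSpace A] {a : A} (ha : IsUnit a) : ∀ᶠ z in 𝓝 (0 : ℂ), IsUnit (a - z • (1 : A)) := by
  have hc : Continuous fun z : ℂ => a - z • (1 : A) := by fun_prop
  exact (Units.isOpen.preimage hc).mem_nhds (by simpa using ha)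

theorem bijective_of_bijective_restrict_of_bijective_mapQ {R M : Type*} [Ring R] [AddCommGroup M]
    [Module R M] {K : Submodule R M} {f : M →ₗ[R] M} (hf : ∀ x ∈ K, f x ∈ K)
    (hK : Function.Bijective (f.restrict hf)) (hQ : Function.Bijective (K.mapQ K f hf)) :
    Function.Bijective f := by
  have hmk (x : M) : K.mapQ K f hf (K.mkQ x) = K.mkQ (f x) := rfl
  constructor
  · refine (injective_iff_map_eq_zero f).mpr fun x hx => ?_
    have hxK : x ∈ K := (Submodule.Quotient.mk_eq_zero K).mp
      (hQ.1 (by rw [← K.mkQ_apply, hmk, hx, map_zero, map_zero]))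
    exact congrArg Subtype.val (@hK.1 ⟨x, hxK⟩ 0 (Subtype.ext (hx.trans (map_zero f).symm)))
  · intro y
    obtain ⟨x', hx'⟩ := hQ.2 (K.mkQ y)
    obtain ⟨x, rfl⟩ := K.mkQ_surjective x'
    have hyK : y - f x ∈ K := by
      rw [← Submodule.Quotient.mk_eq_zero, ← K.mkQ_apply, map_sub, ← hx', hmk, sub_self]
    obtain ⟨k, hk⟩ := hK.2 ⟨y - f x, hyK⟩
    exact ⟨x + k, by rw [map_add, show f k = y - f x from congrArg Subtype.val hk, add_sub_cancel]⟩

theorem bijective_sub_smul_one_of_isNilpotent {V : Type*} [AddCommGroup V] [Module ℂ V]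
    {f : Module.End ℂ V} (hf : IsNilpotent f) {z : ℂ} (hz : z ≠ 0) :
    Function.Bijective (f - z • (1 : Module.End ℂ V)) := by
  rw [← Module.End.isUnit_iff, sub_eq_neg_add, ← neg_smul]
  exact hf.isUnit_add_left_of_commute (isUnit_one.smul (Units.mk0 (-z) (neg_ne_zero.mpr hz)))
    ((Commute.one_right f).smul_right _)

variable {X : Type*} [NormedAddCommGroup X] [NormedSpace ℂ X] {T : X →L[ℂ] X}

theorem map_mem_ker_pow (T : X →L[ℂ] X) (n : ℕ) : ∀ x ∈ (T ^ n).ker, T x ∈ (T ^ n).ker := by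
  intro x (hx : (T ^ n) x = 0)
  change (T ^ n) (T x) = 0
  rw [← mul_apply_eq_comp, ← pow_succ, pow_succ', mul_apply_eq_comp, hx, map_zero]

theorem isNilpotent_restrict_ker_pow (T : X →L[ℂ] X) (n : ℕ) :
    IsNilpotent ((T : X →ₗ[ℂ] X).restrict (map_mem_ker_pow T n)) := by
  refine ⟨n, LinearMap.ext fun x => Subtype.ext ?_⟩
  rw [Module.End.pow_restrict]
  change ((T : X →ₗ[ℂ] X) ^ n) x = 0
  rw [← ContinuousLinearMap.toLinearMap_pow]
  exact x.2

theorem bijective_mapQ_ker_pow {n : ℕ} (hker : ∀ x, (T ^ (n + 1)) x = 0 → (T ^ n) x = 0)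
    (hrange : ∀ x, ∃ y, (T ^ (n + 1)) y = (T ^ n) x) :
    Function.Bijective ((T ^ n).ker.mapQ (T ^ n).ker (T : X →ₗ[ℂ] X) (map_mem_ker_pow T n)) := by
  constructor
  · rw [injective_iff_map_eq_zero, (Submodule.mkQ_surjective _).forall]
    intro x hx
    rw [Submodule.mkQ_apply] at hx ⊢
    rw [Submodule.mapQ_apply, Submodule.Quotient.mk_eq_zero] at hx
    rw [Submodule.Quotient.mk_eq_zero]
    refine hker x ?_
    rw [pow_succ, mul_apply_eq_comp]
    exact hx
  · rw [Function.Surjective, (Submodule.mkQ_surjective _).forall]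
    intro x
    obtain ⟨y, hy⟩ := hrange x
    refine ⟨Submodule.Quotient.mk y, (Submodule.Quotient.eq _).mpr ?_⟩
    change (T ^ n) (T y - x) = 0
    rw [map_sub, ← hy, pow_succ, mul_apply_eq_comp, sub_self]

variable [CompleteSpace X]

theorem eventually_bijective_mapQ {K : Submodule ℂ X} (hK : IsClosed (K : Set X))
    (hTK : ∀ x ∈ K, T x ∈ K) (h : Function.Bijective (K.mapQ K (T : X →ₗ[ℂ] X) hTK)) :
    ∀ᶠ z in 𝓝 (0 : ℂ), ∃ hz : ∀ x ∈ K, (T - z • (1 : X →L[ℂ] X)) x ∈ K,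
      Function.Bijective (K.mapQ K ((T - z • (1 : X →L[ℂ] X) : X →L[ℂ] X) : X →ₗ[ℂ] X) hz) := by
  have hle : K ≤ (K.mkQL ∘L T).ker := fun x hx => by simpa using hTK x hx
  have hu : IsUnit (K.liftQL (K.mkQL ∘L T) hle) := ContinuousLinearMap.isUnit_iff_bijective.mpr h
  filter_upwards [eventually_isUnit_sub_smul_one (A := (X ⧸ K) →L[ℂ] (X ⧸ K)) hu] with z hz
  refine ⟨fun x hx => K.sub_mem (hTK x hx) (K.smul_mem z hx), ?_⟩
  convert ContinuousLinearMap.isUnit_iff_bijective.mp hz using 1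
  ext x
  obtain ⟨x, rfl⟩ := K.mkQ_surjective x
  rfl

/- On `ker T ^ n` the operator is nilpotent and on `X / ker T ^ n` it is invertible, so for small
`z ≠ 0` the operator `T - z` is invertible on both. -/
theorem IsDrazinInvertible.eventually_isUnit_sub_smul_one (h : IsDrazinInvertible T) :
    ∀ᶠ z in 𝓝[≠] (0 : ℂ), IsUnit (T - z • (1 : X →L[ℂ] X)) := by
  obtain ⟨n, hker, hrange⟩ := ((hasFiniteAscent_iff_eventually.mp h.1).and
    (hasFiniteDescent_iff_eventually.mp h.2)).exists
  filter_upwards [eventually_nhdsWithin_of_eventually_nhds (eventually_bijective_mapQ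
    (T ^ n).isClosed_ker (map_mem_ker_pow T n) (bijective_mapQ_ker_pow hker hrange)),
    self_mem_nhdsWithin] with z ⟨hzK, hz⟩ hz0
  exact ContinuousLinearMap.isUnit_iff_bijective.mpr
    (bijective_of_bijective_restrict_of_bijective_mapQ hzK
      (bijective_sub_smul_one_of_isNilpotent (isNilpotent_restrict_ker_pow T n) hz0) hz)

theorem derivedSet_spectrum_subset (s : SpectrumKind) (T : X →L[ℂ] X) :
    derivedSet (spectrum ℂ T) ⊆ starSpectrum s T := by
  intro z hz
  rw [mem_starSpectrum]
  intro hreg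
  rw [mem_derivedSet, accPt_iff_frequently_nhdsNE] at hz
  have hmap : Tendsto (· - z) (𝓝[≠] z) (𝓝[≠] 0) := by
    refine tendsto_nhdsWithin_iff.mpr ⟨tendsto_nhdsWithin_of_tendsto_nhds ?_, ?_⟩
    · simpa only [id_eq, sub_self] using (tendsto_id (x := 𝓝 z)).sub_const z
    · exact eventually_mem_nhdsWithin.mono fun w hw => sub_ne_zero.mpr hw
  refine hz ((hmap.eventually hreg.isDrazinInvertible.eventually_isUnit_sub_smul_one).mono
    fun w hw => ?_)
  refine not_not.mpr ?_ ∘ mem_spectrum_iff_not_isUnit_sub_smul_one.mp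
  rwa [sub_sub, ← add_smul, add_sub_cancel] at hw

theorem isClosed_starSpectrum (s : SpectrumKind) (T : X →L[ℂ] X) :
    IsClosed (starSpectrum s T) :=
  (isClosed_iff_derivedSet_subset _).mpr
    ((derivedSet_mono _ _ (starSpectrum_subset_spectrum s T)).trans
      (derivedSet_spectrum_subset s T))

end IsolatedPoints

section Reduction

variable {X : Type*} [NormedAddCommGroup X] [NormedSpace ℂ X]

theorem isRed_ker_range {P T : X →L[ℂ] X} (hP : IsIdempotentElem P) (hT : Commute T P) :
    IsRed T P.ker P.range where
  isClosed_left := P.isClosed_ker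
  isClosed_right := (ContinuousLinearMap.IsIdempotentElem.isTopCompl hP).isClosed
  map_left x (hx : P x = 0) :=
    show P (T x) = 0 by rw [← mul_apply_eq_comp, ← hT.eq, mul_apply_eq_comp, hx, map_zero]
  map_right := by
    rintro _ ⟨x, rfl⟩
    exact ⟨T x, (DFunLike.congr_fun hT.eq x).symm⟩
  isCompl := (ContinuousLinearMap.IsIdempotentElem.isTopCompl hP).isCompl.symm

theorem comm2_subset_comm1 (T : X →L[ℂ] X) : comm2 T ⊆ comm1 T := fun _ hS => hS T rfl

theorem one_sub_mul_mem_comm2 {S T : X →L[ℂ] X} (hS : S ∈ comm2 T) : 1 - T * S ∈ comm2 T :=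
  fun R hR => (commute_one_sub_mul hR (hS R hR).symm).symm.eq

theorem isRedSq_ker_range {P T : X →L[ℂ] X} (hP : IsIdempotentElem P) (hPT : P ∈ comm2 T) :
    IsRedSq T P.ker P.range := fun R hR => isRed_ker_range hP (hPT R hR).symm

theorem starSpectrum_zero_subset (s : SpectrumKind) : starSpectrum s (0 : X →L[ℂ] X) ⊆ {0} := by
  intro z hz
  by_contra hz0
  refine spectrum.mem_iff.mp (starSpectrum_subset_spectrum s _ hz) ?_
  rw [sub_zero]
  exact (isUnit_iff_ne_zero.mpr hz0).map (algebraMap ℂ (X →L[ℂ] X))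

variable [CompleteSpace X] {s : SpectrumKind} {γ : Ordinal} {T : X →L[ℂ] X}

theorem IsRed.exists_isDirectSum {M N : Submodule ℂ X} (h : IsRed T M N) :
    ∃ p q, IsDirectSum T (T.restrict h.map_left) (T.restrict h.map_right)
      M.subtypeL p N.subtypeL q := by
  have hc := Submodule.IsCompl.isTopCompl_of_isClosed h.isCompl h.isClosed_left h.isClosed_right
  have hsum (x : X) : (M.projectionOntoL N hc x : X) + (N.projectionOntoL M hc.symm x : X) = x :=
    DFunLike.congr_fun (Submodule.projectionL_add_projectionL_eq_id hc) x
  have hT (x : X) : T x = T (M.projectionOntoL N hc x) + T (N.projectionOntoL M hc.symm x) := by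
    rw [← map_add, hsum]
  refine ⟨M.projectionOntoL N hc, N.projectionOntoL M hc.symm, ⟨?_, fun _ => rfl, fun x => ?_⟩,
    ⟨?_, fun _ => rfl, fun x => ?_⟩, hsum⟩
  · exact Submodule.projectionOntoL_apply_left hc
  · rw [hT x, map_add, Submodule.projectionOntoL_apply_eq_zero_of_mem_right hc
      (h.map_right _ (N.projectionOntoL M hc.symm x).2), add_zero]
    exact Submodule.projectionOntoL_apply_left hc (T.restrict h.map_left _)
  · exact Submodule.projectionOntoL_apply_left hc.symm
  · rw [hT x, map_add, Submodule.projectionOntoL_apply_eq_zero_of_mem_right hc.symm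
      (h.map_left _ (M.projectionOntoL N hc x).2), zero_add]
    exact Submodule.projectionOntoL_apply_left hc.symm (T.restrict h.map_right _)

theorem exists_isSummand_restrict_ker {P R : X →L[ℂ] X} (hP : IsIdempotentElem P)
    (hR : Commute R P) (hT : Commute T P) (hRT : ∀ x, P x = 0 → R x = T x) :
    ∃ i p, IsSummand R (T.restrict (isRed_ker_range hP hT).map_left) i p := by
  obtain ⟨p, _, h⟩ := (isRed_ker_range hP hR).exists_isDirectSum
  have hrestrict : R.restrict (isRed_ker_range hP hR).map_left =
      T.restrict (isRed_ker_range hP hT).map_left :=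
    ContinuousLinearMap.ext fun x => Subtype.ext (hRT x x.2)
  exact ⟨_, p, hrestrict ▸ h.left⟩

theorem starSpectrum_mul_eq {P : X →L[ℂ] X} (hP : IsIdempotentElem P) (hT : Commute T P)
    (s : SpectrumKind) : starSpectrum s (T * P) = starSpectrum s (0 : P.ker →L[ℂ] P.ker) ∪
      starSpectrum s (T.restrict (isRed_ker_range hP hT).map_right) := by
  have hred := isRed_ker_range hP (hT.mul_left (Commute.refl P))
  obtain ⟨p, q, h⟩ := hred.exists_isDirectSum
  have hker : (T * P).restrict hred.map_left = 0 :=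
    ContinuousLinearMap.ext fun x => Subtype.ext ((congrArg T x.2).trans (map_zero T))
  have hrange : (T * P).restrict hred.map_right =
      T.restrict (isRed_ker_range hP hT).map_right := by
    ext ⟨_, x, rfl⟩
    exact congrArg T (DFunLike.congr_fun hP x)
  rw [h.starSpectrum_eq s, hker, hrange]

theorem cbDeriv_starSpectrum_mul_subset {P : X →L[ℂ] X} (hP : IsIdempotentElem P)
    (hT : Commute T P) (s : SpectrumKind) (γ : Ordinal) :
    cbDeriv (starSpectrum s (T * P)) γ ⊆ insert 0 (cbDeriv (starSpectrum s T) γ) := by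
  have hred := isRed_ker_range hP hT
  obtain ⟨p, q, h⟩ := hred.exists_isDirectSum
  have := hred.isClosed_left.completeSpace_coe
  have := hred.isClosed_right.completeSpace_coe
  rw [starSpectrum_mul_eq hP hT, cbDeriv_union (isClosed_starSpectrum s _)
    (isClosed_starSpectrum s _)]
  exact union_subset_union ((cbDeriv_subset (isClosed_starSpectrum s _) γ).trans
    (starSpectrum_zero_subset s)) (cbDeriv_mono (h.right.starSpectrum_subset s) γ)

theorem zero_notMem_cbDeriv_of_isUnit (h : IsUnit T) : 0 ∉ cbDeriv (starSpectrum s T) γ :=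
  fun h0 => spectrum.zero_notMem ℂ h
    (starSpectrum_subset_spectrum s T (cbDeriv_subset (isClosed_starSpectrum s T) γ h0))

theorem IsRed.zero_notMem_cbDeriv {M N : Submodule ℂ X} (h : IsRed T M N)
    (hM : 0 ∉ cbDeriv (starSpectrum s (T.restrict h.map_left)) γ)
    (hN : cbDeriv (starSpectrum s (T.restrict h.map_right)) γ ⊆ {0}) :
    0 ∉ cbDeriv (starSpectrum s T) (γ + 1) := by
  obtain ⟨p, q, hd⟩ := h.exists_isDirectSum
  have := h.isClosed_left.completeSpace_coe
  have := h.isClosed_right.completeSpace_coe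
  have hMc := isClosed_starSpectrum s (T.restrict h.map_left)
  rw [hd.starSpectrum_eq s, cbDeriv_union hMc (isClosed_starSpectrum s _)]
  rintro (h0 | h0)
  · exact hM (cbDeriv_add_one_subset hMc γ h0)
  · rw [cbDeriv_add_one, derivedSet_eq_empty_of_finite ((finite_singleton 0).subset hN)] at h0
    exact h0

theorem IsGDecomp.zero_notMem_cbDeriv {M N : Submodule ℂ X} (h : IsGDecomp s γ T M N) :
    0 ∉ cbDeriv (starSpectrum s T) (γ + 1) := by
  obtain ⟨hred, hM, hN⟩ := h
  have := hred.isClosed_left.completeSpace_coe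
  exact hred.zero_notMem_cbDeriv (zero_notMem_cbDeriv_of_isUnit hM) hN

theorem IsGInvertible.zero_notMem_cbDeriv {α : Ordinal} (h : IsGInvertible s α T) :
    0 ∉ cbDeriv (starSpectrum s T) α := by
  rcases h with ⟨rfl, h⟩ | ⟨γ, rfl, M, N, h⟩ | ⟨-, γ, hγ, M, N, h⟩
  · rwa [cbDeriv_zero]
  · exact h.zero_notMem_cbDeriv
  · exact fun h0 => h.zero_notMem_cbDeriv
      (cbDeriv_antitone (isClosed_starSpectrum s T) hγ.le h0)

theorem isGDecomp_top_bot_of_isUnit (h : IsUnit T) (s : SpectrumKind) (γ : Ordinal) :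
    IsGDecomp s γ T ⊤ ⊥ := by
  have hred : IsRed T ⊤ ⊥ :=
    ⟨isClosed_univ, isClosed_singleton, fun _ _ => trivial,
      fun x hx => by rw [(Submodule.mem_bot ℂ).mp hx, map_zero]; exact zero_mem _,
      isCompl_top_bot⟩
  obtain ⟨p, q, hd⟩ := hred.exists_isDirectSum
  refine ⟨hred, hd.left.isUnit h, (cbDeriv_subset (isClosed_starSpectrum s _) γ).trans ?_⟩
  rw [Subsingleton.elim (T.restrict hred.map_right) 0]
  exact starSpectrum_zero_subset s

theorem isGInvertible_of_isUnit (h : IsUnit T) (s : SpectrumKind) (α : Ordinal) :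
    IsGInvertible s α T := by
  rcases Ordinal.zero_or_succ_or_isSuccLimit α with rfl | ⟨β, rfl⟩ | hα
  · refine .inl ⟨rfl, ?_⟩
    exact fun h0 => spectrum.zero_notMem ℂ h (starSpectrum_subset_spectrum s T h0)
  · exact .inr (.inl ⟨β, rfl, ⊤, ⊥, isGDecomp_top_bot_of_isUnit h s β⟩)
  · exact .inr (.inr ⟨hα, 0, hα.add_one_lt (pos_iff_ne_zero.mpr hα.ne_bot),
      ⊤, ⊥, isGDecomp_top_bot_of_isUnit h s 0⟩)

theorem zero_notMem_cbDeriv_of_isIdempotentElem {P : X →L[ℂ] X} (hP : IsIdempotentElem P)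
    (hT : Commute T P) (h0 : 0 ∉ cbDeriv (starSpectrum s (T + P)) γ)
    (h : cbDeriv (starSpectrum s (T * P)) γ ⊆ {0}) :
    0 ∉ cbDeriv (starSpectrum s T) (γ + 1) := by
  obtain ⟨i, p, hsummand⟩ := exists_isSummand_restrict_ker hP (hT.add_left (Commute.refl P)) hT
    fun x hx => by rw [add_apply, hx, add_zero]
  refine (isRed_ker_range hP hT).zero_notMem_cbDeriv
    (fun hc => h0 (cbDeriv_mono (hsummand.starSpectrum_subset s) γ hc)) (subset_trans ?_ h)
  rw [starSpectrum_mul_eq hP hT]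
  exact cbDeriv_mono subset_union_right γ

theorem isGDecomp_of_sq_mul_eq_self {S : X →L[ℂ] X} (hST : Commute S T) (hS : S ^ 2 * T = S)
    (h : cbDeriv (starSpectrum s (T - T ^ 2 * S)) γ ⊆ {0}) :
    IsGDecomp s γ T (1 - T * S).ker (1 - T * S).range := by
  have hP := isIdempotentElem_one_sub_mul hST hS
  have hT : Commute T (1 - T * S) := commute_one_sub_mul (Commute.refl T) hST.symm
  have hTS : Commute (T * S) (1 - T * S) :=
    hT.mul_left (commute_one_sub_mul hST (Commute.refl S))
  obtain ⟨i, p, hsummand⟩ := exists_isSummand_restrict_ker hP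
    ((hT.mul_left hTS).add_left (Commute.refl (1 - T * S))) hT fun x hx => by
      have hx' : T (S x) = x := (sub_eq_zero.mp hx).symm
      rw [add_apply, hx, add_zero, mul_apply_eq_comp, mul_apply_eq_comp, hx']
  refine ⟨isRed_ker_range hP hT, hsummand.isUnit (isUnit_mul_mul_add_one_sub_mul hST hS),
    subset_trans ?_ h⟩
  rw [sub_sq_mul, starSpectrum_mul_eq hP hT]
  exact cbDeriv_mono subset_union_right γ

theorem exists_mem_comm2_sq_mul_eq_self (h : 0 ∉ cbDeriv (starSpectrum s T) (γ + 1)) :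
    ∃ S ∈ comm2 T, S ^ 2 * T = S ∧ IsUnit (T + (1 - T * S)) ∧
      cbDeriv (starSpectrum s (T - T ^ 2 * S)) γ ⊆ {0} := by
  obtain ⟨ρ, hρ0, hρ1, hρ, hacc⟩ := exists_sphere_disjoint_of_zero_notMem_cbDeriv
    (spectrum.isClosed T) (derivedSet_spectrum_subset s T) h
  obtain ⟨S, hcS, hS, hspec⟩ := exists_sq_mul_eq_self_of_norm_ne hρ0 hρ
  have hST : Commute S T := (hcS T (Commute.refl T)).symm
  have hP := isIdempotentElem_one_sub_mul hST hS
  have hTP : Commute T (1 - T * S) := commute_one_sub_mul (Commute.refl T) hST.symm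
  refine ⟨S, fun R hR => (hcS R hR).symm.eq, hS,
    isUnit_add_of_isUnit_one_add_mul hP hTP ?_ ?_, ?_⟩
  · rw [sub_sub_cancel]
    exact isUnit_mul_mul_add_one_sub_mul hST hS
  · by_contra hu
    have hmem : (-1 : ℂ) ∈ spectrum ℂ (T - T ^ 2 * S) := by
      rw [mem_spectrum_iff_not_isUnit_sub_smul_one, neg_one_smul, sub_neg_eq_add, add_comm,
        sub_sq_mul]
      exact hu
    have hlt := hspec _ hmem
    rw [norm_neg, norm_one] at hlt
    exact hlt.not_gt hρ1
  · rw [sub_sq_mul] at hspec ⊢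
    intro z hz
    refine (cbDeriv_starSpectrum_mul_subset hP hTP s γ hz).elim id fun hzT =>
      hacc z hzT (hspec z (starSpectrum_subset_spectrum s _ ?_)).le
    exact cbDeriv_subset (isClosed_starSpectrum s _) γ hz

theorem exists_isSpectralSet_of_zero_notMem_cbDeriv
    (h : 0 ∉ cbDeriv (starSpectrum s T) (γ + 1)) :
    ∃ A : Set ℂ, IsSpectralSet T A ∧ 0 ∉ spectrum ℂ T \ A ∧ A \ {0} ⊆ specPi s γ T := by
  obtain ⟨ρ, hρ0, -, hρ, hacc⟩ := exists_sphere_disjoint_of_zero_notMem_cbDeriv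
    (spectrum.isClosed T) (derivedSet_spectrum_subset s T) h
  refine ⟨spectrum ℂ T ∩ Metric.closedBall 0 ρ, ⟨inter_subset_left, ?_, ?_⟩, ?_, ?_⟩
  · exact ((spectrum.isClosed T).inter Metric.isClosed_closedBall).preimage continuous_subtype_val
  · have hball : ((↑) ⁻¹' (spectrum ℂ T ∩ Metric.closedBall 0 ρ) : Set (spectrum ℂ T)) =
        (↑) ⁻¹' (Metric.ball (0 : ℂ) ρ) := by
      ext ⟨z, hz⟩
      simpa [hz] using (lt_iff_le_and_ne.trans (and_iff_left (hρ z hz))).symm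
    rw [hball]
    exact Metric.isOpen_ball.preimage continuous_subtype_val
  · exact fun h0 => h0.2 ⟨h0.1, Metric.mem_closedBall_self hρ0.le⟩
  · rintro z ⟨⟨hz, hzρ⟩, hz0⟩
    exact ⟨hz, fun hc => hz0 (hacc z hc (mem_closedBall_zero_iff.mp hzρ))⟩

theorem IsSpectralSet.zero_notMem_cbDeriv {A : Set ℂ} (hA : IsSpectralSet T A)
    (h0 : 0 ∉ spectrum ℂ T \ A) (h : A \ {0} ⊆ specPi s γ T) :
    0 ∉ cbDeriv (starSpectrum s T) (γ + 1) := by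
  have hsub : cbDeriv (starSpectrum s T) γ ⊆ spectrum ℂ T :=
    (cbDeriv_subset (isClosed_starSpectrum s T) γ).trans (starSpectrum_subset_spectrum s T)
  obtain ⟨U, hU, hUA⟩ := isOpen_induced_iff.mp hA.2.isOpen
  have hUA' : ∀ z ∈ spectrum ℂ T, z ∈ U ↔ z ∈ A := fun z hz => Set.ext_iff.mp hUA ⟨z, hz⟩
  rw [cbDeriv_add_one, mem_derivedSet]
  intro hacc
  have hmem : (0 : ℂ) ∈ spectrum ℂ T := (spectrum.isClosed T).closure_subset_iff.mpr hsub
    (derivedSet_subset_closure _ hacc)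
  have hU0 : (0 : ℂ) ∈ U := (hUA' 0 hmem).mpr (by_contra fun hc => h0 ⟨hmem, hc⟩)
  obtain ⟨y, ⟨hyU, hy⟩, hy0⟩ := accPt_iff_nhds.mp hacc U (hU.mem_nhds hU0)
  exact (h ⟨(hUA' y (hsub hy)).mp hyU, hy0⟩).2 hy

end Reduction

theorem mainTheorem4 {X : Type*} [NormedAddCommGroup X] [NormedSpace ℂ X] [CompleteSpace X]
    (s : SpectrumKind) (α γ : Ordinal) (hα : α = γ + 1) (T : X →L[ℂ] X) :
    List.TFAE [
      IsGInvertible s α T,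
      0 ∉ cbDeriv (starSpectrum s T) α,
      ∃ M N : Submodule ℂ X, IsRedSq T M N ∧ IsGDecomp s γ T M N,
      ∃ A : Set ℂ, IsSpectralSet T A ∧ 0 ∉ spectrum ℂ T \ A ∧ A \ {0} ⊆ specPi s γ T,
      ∃ P ∈ comm1 T, IsIdempotentElem P ∧ IsGInvertible s γ (T + P) ∧
        cbDeriv (starSpectrum s (T * P)) γ ⊆ {0},
      ∃ P ∈ comm2 T, IsIdempotentElem P ∧ IsGInvertible s γ (T + P) ∧
        cbDeriv (starSpectrum s (T * P)) γ ⊆ {0},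
      ∃ S ∈ comm1 T, S ^ 2 * T = S ∧ cbDeriv (starSpectrum s (T - T ^ 2 * S)) γ ⊆ {0},
      ∃ S ∈ comm2 T, S ^ 2 * T = S ∧ cbDeriv (starSpectrum s (T - T ^ 2 * S)) γ ⊆ {0}] := by
  subst hα
  have hcomm : comm2 T ⊆ comm1 T := comm2_subset_comm1 T
  tfae_have 1 → 2 := IsGInvertible.zero_notMem_cbDeriv
  tfae_have 2 → 8 := fun h =>
    have ⟨S, hST, hS, _, hacc⟩ := exists_mem_comm2_sq_mul_eq_self h
    ⟨S, hST, hS, hacc⟩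
  tfae_have 8 → 7 := fun ⟨S, hST, h⟩ => ⟨S, hcomm hST, h⟩
  tfae_have 7 → 1 := fun ⟨_, hST, hS, hacc⟩ =>
    .inr (.inl ⟨γ, rfl, _, _, isGDecomp_of_sq_mul_eq_self hST hS hacc⟩)
  tfae_have 8 → 3 := fun ⟨_, hST, hS, hacc⟩ =>
    ⟨_, _, isRedSq_ker_range (isIdempotentElem_one_sub_mul (hcomm hST) hS)
      (one_sub_mul_mem_comm2 hST), isGDecomp_of_sq_mul_eq_self (hcomm hST) hS hacc⟩
  tfae_have 3 → 1 := fun ⟨M, N, _, h⟩ => .inr (.inl ⟨γ, rfl, M, N, h⟩)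
  tfae_have 2 → 6 := fun h =>
    have ⟨S, hST, hS, hu, hacc⟩ := exists_mem_comm2_sq_mul_eq_self h
    ⟨1 - T * S, one_sub_mul_mem_comm2 hST, isIdempotentElem_one_sub_mul (hcomm hST) hS,
      isGInvertible_of_isUnit hu s γ, sub_sq_mul T S ▸ hacc⟩
  tfae_have 6 → 5 := fun ⟨P, hPT, h⟩ => ⟨P, hcomm hPT, h⟩
  tfae_have 5 → 2 := fun ⟨_, hPT, hP, hinv, hacc⟩ =>
    zero_notMem_cbDeriv_of_isIdempotentElem hP (Commute.symm hPT) hinv.zero_notMem_cbDeriv hacc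
  tfae_have 2 → 4 := exists_isSpectralSet_of_zero_notMem_cbDeriv
  tfae_have 4 → 2 := fun ⟨_, hA, h0, h⟩ => hA.zero_notMem_cbDeriv h0 h
  tfae_finish
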